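/- Theorem (Lyndon interpolation for the Grzegorczyk logic). Formulas are built from a set of atomic propositions $p$ and $\bot$ by means of $\to$ and $\Box$ (the other connectives are the usual abbreviations). Let $\mathsf{Grz}$ be the modal logic with the axioms: all Boolean tautologies, $\Box(A\to B)\to(\Box A\to\Box B)$, $\Box A\to\Box\Box A$, $\Box A\to A$, and $\Box(\Box(A\to\Box A)\to A)\to\Box A$, and with the rules modus ponens and $A/\Box A$. Let $\mathit{pos}(A)$ and $\mathit{neg}(A)$ be the sets of atomic propositions with positive, respectively negative, occurrences in $A$, that is, $\mathit{pos}(\bot)=\mathit{neg}(\bot)=\emptyset$, $\mathit{pos}(p)=\{p\}$, $\mathit{neg}(p)=\emptyset$, $\mathit{pos}(A\to B)=\mathit{neg}(A)\cup\mathit{pos}(B)$, $\mathit{neg}(A\to B)=\mathit{pos}(A)\cup\mathit{neg}(B)$, $\mathit{pos}(\Box A)=\mathit{pos}(A)$, $\mathit{neg}(\Box A)=\mathit{neg}(A)$. If $\mathsf{Grz}\vdash A\to B$, then there exists a formula $C$ such that $\mathit{pos}(C)\subseteq\mathit{pos}(A)\cap\mathit{pos}(B)$, $\mathit{neg}(C)\subseteq\mathit{neg}(A)\cap\mathit{neg}(B)$,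 $\mathsf{Grz}\vdash A\to C$ and $\mathsf{Grz}\vdash C\to B$. -/

import Mathlib

/-- Modal formulas over a type of atomic propositions, built from `⊥`, atoms, `→` and `□`.
The other connectives are abbreviations in terms of these. -/
inductive ModalFormula (Atom : Type*) : Type _ where
  | bot : ModalFormula Atom
  | atom (p : Atom) : ModalFormula Atom
  | imp (A B : ModalFormula Atom) : ModalFormula Atom
  | box (A : ModalFormula Atom) : ModalFormula Atom

namespace ModalFormula

variable {Atom : Type*}

/-- Truth value under a Boolean assignment, where atoms and boxed formulas are the units to which
`v` assigns truth values (the values of `v` at other formulas are not used). -/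
def BoolHolds (v : ModalFormula Atom → Prop) : ModalFormula Atom → Prop
  | bot => False
  | atom p => v (atom p)
  | imp A B => BoolHolds v A → BoolHolds v B
  | box A => v (box A)

/-- Boolean tautologies of the modal language, that is, substitution instances of propositional
tautologies. -/
def IsTautology (A : ModalFormula Atom) : Prop :=
  ∀ v : ModalFormula Atom → Prop, BoolHolds v A

/-- The atoms that occur in a formula with the given sign: `true` is for positive occurrences and
`false` for negative ones. An atom occurs positively in itself, the sign changes in the premise of
an implication, and `□` keeps it. -/
def signedAtoms : Bool → ModalFormula Atom → Set Atom
  | _, bot => ∅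
  | true, atom p => {p}
  | false, atom _ => ∅
  | s, imp A B => signedAtoms (!s) A ∪ signedAtoms s B
  | s, box A => signedAtoms s A

/-- The atoms with positive occurrences in a formula. -/
def pos (A : ModalFormula Atom) : Set Atom := signedAtoms true A

/-- The atoms with negative occurrences in a formula. -/
def neg (A : ModalFormula Atom) : Set Atom := signedAtoms false A

/-- Provability in the Hilbert-style axiomatization of the Grzegorczyk logic. -/
inductive GrzProvable : ModalFormula Atom → Prop where
  | taut (A : ModalFormula Atom) (h : IsTautology A) : GrzProvable A
  | axK (A B : ModalFormula Atom) :
      GrzProvable (imp (box (imp A B)) (imp (box A) (box B)))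
  | axFour (A : ModalFormula Atom) : GrzProvable (imp (box A) (box (box A)))
  | axT (A : ModalFormula Atom) : GrzProvable (imp (box A) A)
  | axGrz (A : ModalFormula Atom) :
      GrzProvable (imp (box (imp (box (imp A (box A))) A)) (box A))
  | mp (A B : ModalFormula Atom) (hAB : GrzProvable (imp A B)) (hA : GrzProvable A) :
      GrzProvable B
  | nec (A : ModalFormula Atom) (hA : GrzProvable A) : GrzProvable (box A)

end ModalFormula

/-!
The proof is semantic. Call sets of formulas `Γ`, `Δ` *separable* if some `C` whose positive and
negative atoms lie in prescribed sets `P` and `N` satisfies `Γ ⊢ C` and `Δ ⊢ ¬C`. For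
`P = pos A ∩ pos B` and `N = neg A ∩ neg B`, an interpolant of `A → B` is the same thing as a
separator of `{A}` and `{¬B}`. If these sets are inseparable, a Kripke model of `A ∧ ¬B` is built,
which contradicts the soundness of the logic.

The worlds are the inseparable pairs of complete theories. Separators are closed under disjunction,
so every inseparable pair extends to a world (`exists_world`). If `□D` is missing from the left
theory of a world, then the boxed formulas of the two theories, together with `¬D` and
`□(D → □D)` on the left, are still inseparable, because a separator `C` would make `◇C` a separator
of the given world; here the Grzegorczyk axiom is used (`World.exists_succ_left`). The right-hand
case follows by exchanging the two sides, which exchanges `P` and `N`.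

A world sees itself and those worlds whose theories contain strictly more of the formulas `□D`, for
`D` in a finite set. So the strict accessibility relation is transitive and conversely well founded,
which validates the Grzegorczyk axiom (`GrzProvable.holds`). The formula `□(D → □D)` makes the new
world strictly larger whenever `D` is in the old theory, and if `D` is not in it, the world itself
refutes `□D`.

An atom is true at a world if it is in the left theory and in `pos A`, or in the right theory and in
`neg B`. Since an atom or its negation may separate, this makes an atom of the left theory true if
it is in `pos A`, an atom outside of it false if it is in `neg A`, and similarly on the right. That
is enough for a truth lemma that respects polarities (`truth_lemma`).
-/

namespace ModalFormula

variable {Atom : Type*}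

/-! ### Derivability from a set of formulas -/

/-- Negation, as an abbreviation in terms of `→` and `⊥`. -/
abbrev not (A : ModalFormula Atom) : ModalFormula Atom := imp A bot

/-- Derivability from a set of local hypotheses: all theorems of the logic may be used, but
necessitation is not applied to hypotheses. -/
inductive Derives (Γ : Set (ModalFormula Atom)) : ModalFormula Atom → Prop where
  | hyp {A : ModalFormula Atom} (h : A ∈ Γ) : Derives Γ A
  | thm {A : ModalFormula Atom} (h : GrzProvable A) : Derives Γ A
  | mp {A B : ModalFormula Atom} (hAB : Derives Γ (imp A B)) (hA : Derives Γ A) : Derives Γ B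

namespace Derives

variable {Γ Δ : Set (ModalFormula Atom)} {A B C D : ModalFormula Atom}

theorem taut (h : IsTautology A) : Derives Γ A := thm (.taut A h)

theorem taut_mp (hA : Derives Γ A) (h : IsTautology (imp A B)) : Derives Γ B :=
  mp (taut h) hA

theorem taut_mp₂ (hA : Derives Γ A) (hB : Derives Γ B) (h : IsTautology (imp A (imp B C))) :
    Derives Γ C :=
  mp (taut_mp hA h) hB

theorem mono (h : Derives Γ A) (hΓ : Γ ⊆ Δ) : Derives Δ A := by
  induction h with
  | hyp h => exact hyp (hΓ h)
  | thm h => exact thm h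
  | mp _ _ ih₁ ih₂ => exact mp ih₁ ih₂

theorem deduction (h : Derives (insert A Γ) B) : Derives Γ (imp A B) := by
  induction h with
  | hyp h =>
    rcases h with rfl | h
    · exact taut fun v h => h
    · exact (hyp h).taut_mp fun v h _ => h
  | thm h => exact (thm h).taut_mp fun v h _ => h
  | mp _ _ ih₁ ih₂ => exact ih₁.taut_mp₂ ih₂ fun v f g a => f a (g a)

theorem provable_of_empty (h : Derives ∅ A) : GrzProvable A := by
  induction h with
  | hyp h => exact h.elim
  | thm h => exact h
  | mp _ _ ih₁ ih₂ => exact .mp _ _ ih₁ ih₂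

theorem provable_imp_of_singleton (h : Derives {A} B) : GrzProvable (imp A B) :=
  provable_of_empty (deduction (h.mono (by simp)))

/-- Formulas derived from boxed hypotheses may be boxed, by transitivity. -/
theorem box_of_boxed (h : Derives {X | X ∈ Γ ∧ ∃ D, X = box D} A) : Derives Γ (box A) := by
  induction h with
  | hyp h =>
    obtain ⟨h, D, rfl⟩ := h
    exact mp (thm (.axFour D)) (hyp h)
  | thm h => exact thm (.nec _ h)
  | mp _ _ ih₁ ih₂ => exact mp (mp (thm (.axK _ _)) ih₁) ih₂

theorem exists_mem_of_sUnion {c : Set (Set (ModalFormula Atom))} (hc : IsChain (· ⊆ ·) c)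
    (hne : c.Nonempty) (h : Derives (⋃₀ c) A) : ∃ Γ ∈ c, Derives Γ A := by
  induction h with
  | hyp h =>
    obtain ⟨Γ, hΓ, hA⟩ := h
    exact ⟨Γ, hΓ, hyp hA⟩
  | thm h =>
    obtain ⟨Γ, hΓ⟩ := hne
    exact ⟨Γ, hΓ, thm h⟩
  | mp _ _ ih₁ ih₂ =>
    obtain ⟨Γ₁, h₁, d₁⟩ := ih₁
    obtain ⟨Γ₂, h₂, d₂⟩ := ih₂
    rcases hc.total h₁ h₂ with h | h
    · exact ⟨Γ₂, h₂, mp (d₁.mono h) d₂⟩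
    · exact ⟨Γ₁, h₁, mp d₁ (d₂.mono h)⟩

end Derives

/-! ### Separability -/

/-- Some formula with positive atoms in `P` and negative atoms in `N` follows from `Γ`, while its
negation follows from `Δ`. -/
def Separable (P N : Set Atom) (Γ Δ : Set (ModalFormula Atom)) : Prop :=
  ∃ C : ModalFormula Atom, pos C ⊆ P ∧ neg C ⊆ N ∧ Derives Γ C ∧ Derives Δ (not C)

@[simp] theorem pos_bot : pos (bot : ModalFormula Atom) = ∅ := rfl

@[simp] theorem neg_bot : neg (bot : ModalFormula Atom) = ∅ := rfl

@[simp] theorem pos_atom (p : Atom) : pos (atom p) = {p} := rfl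

@[simp] theorem neg_atom (p : Atom) : neg (atom p) = ∅ := rfl

@[simp] theorem pos_imp (A B : ModalFormula Atom) : pos (imp A B) = neg A ∪ pos B := rfl

@[simp] theorem neg_imp (A B : ModalFormula Atom) : neg (imp A B) = pos A ∪ neg B := rfl

@[simp] theorem pos_box (A : ModalFormula Atom) : pos (box A) = pos A := rfl

@[simp] theorem neg_box (A : ModalFormula Atom) : neg (box A) = neg A := rfl

variable {P N : Set Atom} {Γ Δ : Set (ModalFormula Atom)}

theorem Separable.symm (h : Separable P N Γ Δ) : Separable N P Δ Γ := by
  obtain ⟨C, hP, hN, hΓ, hΔ⟩ := h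
  exact ⟨not C, by simpa using hN, by simpa using hP, hΔ, hΓ.taut_mp fun v h k => k h⟩

/-- The disjunction of a separator for `Γ, X` and one for `Γ, ¬X` separates `Γ`. -/
theorem Separable.of_insert_of_insert_not {X : ModalFormula Atom}
    (h₁ : Separable P N (insert X Γ) Δ) (h₂ : Separable P N (insert (not X) Γ) Δ) :
    Separable P N Γ Δ := by
  obtain ⟨C₁, hP₁, hN₁, hΓ₁, hΔ₁⟩ := h₁
  obtain ⟨C₂, hP₂, hN₂, hΓ₂, hΔ₂⟩ := h₂
  refine ⟨imp (not C₁) C₂, by simp [hP₁, hP₂], by simp [hN₁, hN₂], ?_, ?_⟩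
  · exact hΓ₁.deduction.taut_mp₂ hΓ₂.deduction fun v f g k => g fun x => k (f x)
  · exact hΔ₁.taut_mp₂ hΔ₂ fun v f g k => g (k f)

theorem exists_complete_of_not_separable (h : ¬ Separable P N Γ Δ) :
    ∃ Γ', Γ ⊆ Γ' ∧ ¬ Separable P N Γ' Δ ∧ ∀ X, X ∈ Γ' ∨ not X ∈ Γ' := by
  have hub : ∀ c ⊆ {Γ' | ¬ Separable P N Γ' Δ}, IsChain (· ⊆ ·) c → c.Nonempty →
      ∃ ub ∈ {Γ' | ¬ Separable P N Γ' Δ}, ∀ s ∈ c, s ⊆ ub := by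
    intro c hc hchain hne
    refine ⟨⋃₀ c, ?_, fun s hs => Set.subset_sUnion_of_mem hs⟩
    rintro ⟨C, hP, hN, hΓ, hΔ⟩
    obtain ⟨Γ', hΓ', hd⟩ := hΓ.exists_mem_of_sUnion hchain hne
    exact hc hΓ' ⟨C, hP, hN, hd, hΔ⟩
  obtain ⟨M, hM, hmax⟩ := zorn_subset_nonempty _ hub Γ h
  have mem_of (X) (hX : ¬ Separable P N (insert X M) Δ) : X ∈ M :=
    hmax.le_of_ge hX (Set.subset_insert X M) (Set.mem_insert X M)
  refine ⟨M, hM, hmax.prop, fun X => ?_⟩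
  by_contra! hX
  exact hmax.prop (.of_insert_of_insert_not (not_not.1 fun h => hX.1 (mem_of X h))
    (not_not.1 fun h => hX.2 (mem_of _ h)))

/-! ### Worlds -/

/-- A complete consistent theory. -/
structure IsCompleteTheory (Γ : Set (ModalFormula Atom)) : Prop where
  mem_or_not_mem (X : ModalFormula Atom) : X ∈ Γ ∨ not X ∈ Γ
  not_derives_bot : ¬ Derives Γ bot

namespace IsCompleteTheory

theorem mem_of_derives (h : IsCompleteTheory Γ) {X : ModalFormula Atom} (hX : Derives Γ X) :
    X ∈ Γ :=
  (h.mem_or_not_mem X).resolve_right fun hn => h.not_derives_bot (.mp (.hyp hn) hX)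

theorem not_mem_iff (h : IsCompleteTheory Γ) {X : ModalFormula Atom} : not X ∈ Γ ↔ X ∉ Γ :=
  ⟨fun hn hX => h.not_derives_bot (.mp (.hyp hn) (.hyp hX)), (h.mem_or_not_mem X).resolve_left⟩

theorem imp_mem_iff (h : IsCompleteTheory Γ) {X Y : ModalFormula Atom} :
    imp X Y ∈ Γ ↔ (X ∈ Γ → Y ∈ Γ) := by
  refine ⟨fun hXY hX => h.mem_of_derives (.mp (.hyp hXY) (.hyp hX)), fun hXY => ?_⟩
  rcases h.mem_or_not_mem X with hX | hX
  · exact h.mem_of_derives (.taut_mp (.hyp (hXY hX)) fun v y _ => y)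
  · exact h.mem_of_derives (.taut_mp (.hyp hX) fun v n x => (n x).elim)

theorem mem_of_box_mem (h : IsCompleteTheory Γ) {X : ModalFormula Atom} (hX : box X ∈ Γ) :
    X ∈ Γ :=
  h.mem_of_derives (.mp (.thm (.axT X)) (.hyp hX))

end IsCompleteTheory

/-- A world of the model: an inseparable pair of complete theories. -/
structure World (P N : Set Atom) where
  left : Set (ModalFormula Atom)
  right : Set (ModalFormula Atom)
  insep : ¬ Separable P N left right
  complete_left : ∀ X, X ∈ left ∨ not X ∈ left
  complete_right : ∀ X, X ∈ right ∨ not X ∈ right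

theorem exists_world (h : ¬ Separable P N Γ Δ) :
    ∃ w : World P N, Γ ⊆ w.left ∧ Δ ⊆ w.right := by
  obtain ⟨Γ', hΓ, h, hl⟩ := exists_complete_of_not_separable h
  obtain ⟨Δ', hΔ, h, hr⟩ := exists_complete_of_not_separable fun k => h (Separable.symm k)
  exact ⟨⟨Γ', Δ', fun k => h k.symm, hl, hr⟩, hΓ, hΔ⟩

namespace World

/-- The world with its two theories exchanged; positive and negative atoms change places, as a
separator is replaced by its negation. -/
def swap (w : World P N) : World N P where
  left := w.right
  right := w.left
  insep h := w.insep h.symm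
  complete_left := w.complete_right
  complete_right := w.complete_left

theorem isCompleteTheory_left (w : World P N) : IsCompleteTheory w.left :=
  ⟨w.complete_left, fun h => w.insep ⟨bot, by simp, by simp, h, .taut fun v h => h⟩⟩

theorem isCompleteTheory_right (w : World P N) : IsCompleteTheory w.right :=
  w.swap.isCompleteTheory_left

/-- A formula `□D` outside the left theory is refuted at a world that keeps all boxed formulas and
contains `□(D → □D)` on the left. -/
theorem exists_succ_left (w : World P N) {D : ModalFormula Atom} (hD : box D ∉ w.left) :
    ∃ x : World P N, (∀ E, box E ∈ w.left → box E ∈ x.left) ∧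
      (∀ E, box E ∈ w.right → box E ∈ x.right) ∧
      D ∉ x.left ∧ box (imp D (box D)) ∈ x.left := by
  have insep : ¬ Separable P N
      (insert (not D) (insert (box (imp D (box D))) {X | X ∈ w.left ∧ ∃ E, X = box E}))
      {X | X ∈ w.right ∧ ∃ E, X = box E} := by
    rintro ⟨C, hP, hN, hl, hr⟩
    -- `◇C` separates the theories of `w`
    refine w.insep ⟨not (box (not C)), by simpa using hP, by simpa using hN, ?_, ?_⟩
    · have h₁ : Derives {X | X ∈ w.left ∧ ∃ E, X = box E}
          (imp (not C) (imp (box (imp D (box D))) D)) :=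
        hl.deduction.deduction.taut_mp fun v f k g => by
          by_contra hD
          exact k (f g hD)
      have h₂ := Derives.mp (.thm (.axK _ _)) h₁.box_of_boxed
      have h₃ : Derives w.left (imp (box (not C)) (box D)) :=
        h₂.taut_mp₂ (.thm (.axGrz D)) fun v f g k => g (f k)
      exact h₃.taut_mp₂ (.hyp (w.isCompleteTheory_left.not_mem_iff.2 hD)) fun v f g k => g (f k)
    · exact hr.box_of_boxed.taut_mp fun v f k => k f
  obtain ⟨x, hl, hr⟩ := exists_world insep
  refine ⟨x, fun E hE => hl ?_, fun E hE => hr ⟨hE, E, rfl⟩, ?_, hl (by simp)⟩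
  · exact .inr (.inr ⟨hE, E, rfl⟩)
  · exact x.isCompleteTheory_left.not_mem_iff.1 (hl (by simp))

theorem exists_succ_right (w : World P N) {D : ModalFormula Atom} (hD : box D ∉ w.right) :
    ∃ x : World P N, (∀ E, box E ∈ w.left → box E ∈ x.left) ∧
      (∀ E, box E ∈ w.right → box E ∈ x.right) ∧
      D ∉ x.right ∧ box (imp D (box D)) ∈ x.right := by
  obtain ⟨x, hl, hr, hx⟩ := w.swap.exists_succ_left hD
  exact ⟨x.swap, hr, hl, hx⟩

theorem mem_right_of_mem_left (w : World P N) {p : Atom} (hp : p ∈ P) (hl : atom p ∈ w.left) :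
    atom p ∈ w.right := by
  by_contra hr
  exact w.insep ⟨atom p, by simpa using hp, by simp, .hyp hl,
    .hyp (w.isCompleteTheory_right.not_mem_iff.2 hr)⟩

theorem mem_left_of_mem_right (w : World P N) {p : Atom} (hp : p ∈ N) (hr : atom p ∈ w.right) :
    atom p ∈ w.left :=
  w.swap.mem_right_of_mem_left hp hr

end World

/-! ### Kripke semantics -/

/-- Truth at a world of a Kripke model, where `S` is the strict accessibility relation: a world sees
itself and its `S`-successors. -/
def Holds {W : Type*} (S : W → W → Prop) (V : W → Atom → Prop) : W → ModalFormula Atom → Prop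
  | _, bot => False
  | w, atom p => V w p
  | w, imp A B => Holds S V w A → Holds S V w B
  | w, box A => Holds S V w A ∧ ∀ x, S w x → Holds S V x A

section Kripke

variable {W : Type*} {S : W → W → Prop} {V : W → Atom → Prop}

theorem boolHolds_holds_iff (w : W) (A : ModalFormula Atom) :
    BoolHolds (Holds S V w) A ↔ Holds S V w A := by
  induction A with
  | bot => rfl
  | atom p => rfl
  | imp A B ihA ihB => simp only [BoolHolds, Holds, ihA, ihB]
  | box A => rfl

/-- Soundness for transitive, conversely well-founded strict accessibility relations. -/
theorem GrzProvable.holds {A : ModalFormula Atom} (h : GrzProvable A)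
    (htrans : ∀ x y z, S x y → S y z → S x z) (hwf : WellFounded fun x y => S y x) (w : W) :
    Holds S V w A := by
  induction h generalizing w with
  | taut A h => exact (boolHolds_holds_iff w A).1 (h _)
  | axK A B => exact fun hAB hA => ⟨hAB.1 hA.1, fun x hx => hAB.2 x hx (hA.2 x hx)⟩
  | axFour A =>
    exact fun hA => ⟨hA, fun x hx => ⟨hA.2 x hx, fun y hy => hA.2 y (htrans w x y hx hy)⟩⟩
  | axT A => exact fun hA => hA.1
  | axGrz A =>
    intro h
    have key : ∀ x, x = w ∨ S w x → Holds S V x A := by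
      intro x
      induction x using hwf.induction with
      | _ x ih =>
        intro hx
        have hS : ∀ y, S x y → S w y := fun y hy => by
          rcases hx with rfl | hx
          · exact hy
          · exact htrans w x y hx hy
        have hA : ∀ y, S x y → Holds S V y A := fun y hy => ih y hy (.inr (hS y hy))
        have hbox : Holds S V x (box (imp A (box A))) :=
          ⟨fun hxA => ⟨hxA, hA⟩, fun y hy hyA => ⟨hyA, fun z hz => hA z (htrans x y z hy hz)⟩⟩
        rcases hx with rfl | hx
        · exact h.1 hbox
        · exact h.2 x hx hbox
    exact ⟨key w (.inl rfl), fun x hx => key x (.inr hx)⟩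
  | mp A B _ _ ih₁ ih₂ => exact ih₁ w (ih₂ w)
  | nec A _ ih => exact ⟨ih w, fun x _ => ih x⟩

/-- The formulas `D` such that strict accessibility has to take account of `□D`, if the truth of the
given formula is to be controlled: bodies `X` of boxed subformulas, and the corresponding
`X → □X`. -/
def boxBodies : ModalFormula Atom → Set (ModalFormula Atom)
  | bot => ∅
  | atom _ => ∅
  | imp A B => boxBodies A ∪ boxBodies B
  | box A => {A, imp A (box A)} ∪ boxBodies A

theorem finite_boxBodies (A : ModalFormula Atom) : (boxBodies A).Finite := by
  induction A with
  | bot => exact Set.finite_empty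
  | atom p => exact Set.finite_empty
  | imp A B ihA ihB => exact ihA.union ihB
  | box A ih => exact (Set.toFinite _).union ih

/-- Polarised truth lemma. If the valuation agrees with the theories `th w` on the atoms of `P` as
far as membership is concerned, and on those of `N` as far as non-membership is concerned, then
members of `th w` that are positive in `P` and negative in `N` hold at `w`, and non-members with the
opposite polarities fail. -/
theorem truth_lemma {th : W → Set (ModalFormula Atom)} {T : Set (ModalFormula Atom)}
    (hth : ∀ w, IsCompleteTheory (th w))
    (hV : ∀ w, ∀ p ∈ P, atom p ∈ th w → V w p) (hV' : ∀ w, ∀ p ∈ N, atom p ∉ th w → ¬ V w p)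
    (hS : ∀ w x, S w x → ∀ D ∈ T, box D ∈ th w → box D ∈ th x)
    (hsucc : ∀ w D, imp D (box D) ∈ T → D ∈ th w → box D ∉ th w → ∃ x, S w x ∧ D ∉ th x)
    (X : ModalFormula Atom) (hX : boxBodies X ⊆ T) :
    (pos X ⊆ P → neg X ⊆ N → ∀ w, X ∈ th w → Holds S V w X) ∧
      (neg X ⊆ P → pos X ⊆ N → ∀ w, X ∉ th w → ¬ Holds S V w X) := by
  induction X with
  | bot => exact ⟨fun _ _ w h => ((hth w).not_derives_bot (.hyp h)).elim, fun _ _ _ _ h => h⟩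
  | atom p => exact ⟨fun h _ w => hV w p (h rfl), fun _ h w => hV' w p (h rfl)⟩
  | imp A B ihA ihB =>
    simp only [boxBodies, Set.union_subset_iff] at hX
    simp only [pos_imp, neg_imp, Set.union_subset_iff, Holds, (hth _).imp_mem_iff]
    refine ⟨fun hp hn w h hA => ?_, fun hn hp w h hAB => ?_⟩
    · exact (ihB hX.2).1 hp.2 hn.2 w
        (h (not_not.1 fun hA' => (ihA hX.1).2 hp.1 hn.1 w hA' hA))
    · push Not at h
      exact (ihB hX.2).2 hn.2 hp.2 w h.2 (hAB ((ihA hX.1).1 hn.1 hp.1 w h.1))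
  | box A ih =>
    simp only [boxBodies, Set.union_subset_iff, Set.insert_subset_iff,
      Set.singleton_subset_iff] at hX
    refine ⟨fun hp hn w h => ?_, fun hn hp w h hA => ?_⟩
    · exact ⟨(ih hX.2).1 hp hn w ((hth w).mem_of_box_mem h), fun x hx =>
        (ih hX.2).1 hp hn x ((hth x).mem_of_box_mem (hS w x hx A hX.1.1 h))⟩
    · by_cases hAw : A ∈ th w
      · obtain ⟨x, hx, hAx⟩ := hsucc w A hX.1.2 hAw h
        exact (ih hX.2).2 hn hp x hAx (hA.2 x hx)
      · exact (ih hX.2).2 hn hp w hAw hA.1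

end Kripke

/-! ### The model of inseparable pairs -/

namespace World

/-- The formulas `D ∈ T` for which `□D` is in the left theory, and those for which it is in the
right theory. -/
def boxes (T : Set (ModalFormula Atom)) (w : World P N) : Set T × Set T :=
  ({D | box D.1 ∈ w.left}, {D | box D.1 ∈ w.right})

theorem wellFounded_boxes_lt {T : Set (ModalFormula Atom)} (hT : T.Finite) :
    WellFounded fun x y : World P N => boxes T y < boxes T x := by
  have := hT.to_subtype
  exact InvImage.wf (boxes T) (wellFounded_gt (α := Set T × Set T))

theorem boxes_le {T : Set (ModalFormula Atom)} {w x : World P N}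
    (hl : ∀ E, box E ∈ w.left → box E ∈ x.left) (hr : ∀ E, box E ∈ w.right → box E ∈ x.right) :
    boxes T w ≤ boxes T x :=
  ⟨fun E => hl E.1, fun E => hr E.1⟩

end World

/-- Otherwise the model of inseparable pairs would have a world at which `A` holds and `B` fails. -/
theorem separable_of_provable_imp {A B : ModalFormula Atom} (h : GrzProvable (imp A B)) :
    Separable (pos A ∩ pos B) (neg A ∩ neg B) {A} {not B} := by
  by_contra hsep
  obtain ⟨w, hl, hr⟩ := exists_world hsep
  let W := World (pos A ∩ pos B) (neg A ∩ neg B)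
  let T := boxBodies A ∪ boxBodies B
  let S : W → W → Prop := fun x y => x.boxes T < y.boxes T
  let V : W → Atom → Prop := fun x p =>
    (p ∈ pos A ∧ atom p ∈ x.left) ∨ (p ∈ neg B ∧ atom p ∈ x.right)
  have hA : Holds S V w A := by
    refine (truth_lemma (th := World.left) (P := pos A) (N := neg A) (T := T)
      World.isCompleteTheory_left (fun x p hp hx => .inl ⟨hp, hx⟩) ?_ ?_ ?_ A
      Set.subset_union_left).1 subset_rfl subset_rfl w (hl rfl)
    · rintro x p hp hx (⟨-, h⟩ | ⟨hpB, h⟩)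
      · exact hx h
      · exact hx (x.mem_left_of_mem_right ⟨hp, hpB⟩ h)
    · exact fun x y hxy D hD hx => hxy.le.1 (show ⟨D, hD⟩ ∈ (x.boxes T).1 from hx)
    · intro x D hT hD hbD
      obtain ⟨y, hyl, hyr, hDy, hy⟩ := x.exists_succ_left hbD
      refine ⟨y, lt_of_le_not_ge (World.boxes_le hyl hyr) fun hle => hbD ?_, hDy⟩
      have hx : box (imp D (box D)) ∈ x.left := hle.1 (show ⟨_, hT⟩ ∈ (y.boxes T).1 from hy)
      have hth := x.isCompleteTheory_left
      exact hth.imp_mem_iff.1 (hth.mem_of_box_mem hx) hD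
  have hB : ¬ Holds S V w B := by
    refine (truth_lemma (th := World.right) (P := neg B) (N := pos B) (T := T)
      World.isCompleteTheory_right (fun x p hp hx => .inr ⟨hp, hx⟩) ?_ ?_ ?_ B
      Set.subset_union_right).2 subset_rfl subset_rfl w
      (w.isCompleteTheory_right.not_mem_iff.1 (hr rfl))
    · rintro x p hp hx (⟨hpA, h⟩ | ⟨-, h⟩)
      · exact hx (x.mem_right_of_mem_left ⟨hpA, hp⟩ h)
      · exact hx h
    · exact fun x y hxy D hD hx => hxy.le.2 (show ⟨D, hD⟩ ∈ (x.boxes T).2 from hx)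
    · intro x D hT hD hbD
      obtain ⟨y, hyl, hyr, hDy, hy⟩ := x.exists_succ_right hbD
      refine ⟨y, lt_of_le_not_ge (World.boxes_le hyl hyr) fun hle => hbD ?_, hDy⟩
      have hx : box (imp D (box D)) ∈ x.right := hle.2 (show ⟨_, hT⟩ ∈ (y.boxes T).2 from hy)
      have hth := x.isCompleteTheory_right
      exact hth.imp_mem_iff.1 (hth.mem_of_box_mem hx) hD
  exact hB (h.holds (S := S) (fun x y z => lt_trans)
    (World.wellFounded_boxes_lt ((finite_boxBodies A).union (finite_boxBodies B))) w hA)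

end ModalFormula

theorem mainTheorem2 {Atom : Type*} (A B : ModalFormula Atom)
    (hAB : ModalFormula.GrzProvable (ModalFormula.imp A B)) :
    ∃ C : ModalFormula Atom,
      ModalFormula.pos C ⊆ ModalFormula.pos A ∩ ModalFormula.pos B ∧
      ModalFormula.neg C ⊆ ModalFormula.neg A ∩ ModalFormula.neg B ∧
      ModalFormula.GrzProvable (ModalFormula.imp A C) ∧
      ModalFormula.GrzProvable (ModalFormula.imp C B) := by
  obtain ⟨C, hP, hN, hA, hB⟩ := ModalFormula.separable_of_provable_imp hAB
  refine ⟨C, hP, hN, hA.provable_imp_of_singleton, ?_⟩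
  refine .mp _ _ (.taut _ fun v f c => ?_) hB.provable_imp_of_singleton
  by_contra hB'
  exact f hB' c
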